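/- Let $S$ be a compact, connected, oriented smooth surface (without boundary) with a finite set $P$ of marked points. An essential closed $1$-manifold is a disjoint union of finitely many smooth simple closed curves in $S\setminus P$, its components, each of which is neither null-homotopic in $S\setminus P$ nor isotopic to a puncture of $S \setminus P$ (components may be isotopic to each other). For simple closed curves $a,b$ in $S\setminus P$, the geometric intersection number $i(a,b)$ is the minimal number of intersection points of transverse representatives of the isotopy classes of $a$ and $b$ in $S\setminus P$. The spectral radius $\mu(M)$ of a square real matrix $M$ is the maximum of the moduli of its complex eigenvalues ($0$ for the empty matrix). Let $A=a_1\cup\dots\cup a_n$ and $B=b_1\cup\dots\cup b_m$ be essential closed $1$-manifolds that meet transversely and minimally, that is, the number of points in which a component of $A$ meets a component of $B$ cannot be decreased by isotopies of these two curves. The configuration graph $\mathcal G(A\cup B)$ is the multigraph with a vertex for each component of $A$ and of $B$ and an edge for every point of intersection between two components, joining the corresponding vertices. The adjacency matrix $\mathcal{A}d(\mathcal G)$ of a multigraph $\mathcal G$ has as $(x,y)$ entry the number of edges joining $x$ to $y$, and its spectral radius is denoted $\mu(\mathcal G)$. Let $N$ be the $n\times m$ matrix with entries $N_{ij}=i(a_i,b_j)$,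 and let Thurston's parameter be $\mu(A\cup B)=\sqrt{\mu(NN^t)}$. Then, with the vertices in the order $a_1,\dots,a_n,b_1,\dots,b_m$, $$\mathcal{A}d(\mathcal G(A\cup B))=\begin{pmatrix}0&N\\N^t&0\end{pmatrix},$$ and consequently $\mu(A\cup B)=\sqrt{\mu(NN^t)}=\mu(\mathcal G(A\cup B))$. -/

import Mathlib

open scoped Manifold ContDiff Topology

noncomputable section

/-- A smooth surface is orientable if the charts of some smooth atlas (compatible with the given
smooth structure) have transition maps with everywhere positive Jacobian determinant. -/
def OrientableSurface (S : Type*) [TopologicalSpace S]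
    [ChartedSpace (EuclideanSpace ℝ (Fin 2)) S] : Prop :=
  ∃ atl ⊆ IsManifold.maximalAtlas (𝓡 2) ∞ S,
    (∀ x : S, ∃ e ∈ atl, x ∈ e.source) ∧
    ∀ e ∈ atl, ∀ e' ∈ atl, ∀ y ∈ (e.symm.trans e').source,
      0 < (fderiv ℝ (e.symm.trans e') y).det

/-- A smooth simple closed curve on the punctured surface `S ∖ P`, with a smooth parametrization
by the circle. -/
structure SimpleClosedCurve (S : Type*) [TopologicalSpace S]
    [ChartedSpace (EuclideanSpace ℝ (Fin 2)) S] (P : Finset S) where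
  toFun : Circle → S
  isSmoothEmbedding : Manifold.IsSmoothEmbedding (𝓡 1) (𝓡 2) ∞ toFun
  avoids : ∀ z, toFun z ∉ P

namespace SimpleClosedCurve

variable {S : Type*} [TopologicalSpace S] [ChartedSpace (EuclideanSpace ℝ (Fin 2)) S]
  {P : Finset S}

/-- The curve as a subset of the surface. -/
def carrier (c : SimpleClosedCurve S P) : Set S := Set.range c.toFun

/-- The curve as a continuous map to the punctured surface. -/
def toPunctured (c : SimpleClosedCurve S P) : C(Circle, {x : S // x ∉ P}) where
  toFun z := ⟨c.toFun z, c.avoids z⟩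
  continuous_toFun := c.isSmoothEmbedding.isEmbedding.continuous.subtype_mk c.avoids

/-- Isotopy of (unparametrized) simple closed curves in the punctured surface `S ∖ P`: a smooth
family of embeddings of the circle into `S ∖ P`, with time in `[0, 1]`, whose image moves from
the first curve to the second one. -/
def Isotopic (c d : SimpleClosedCurve S P) : Prop :=
  ∃ F : ℝ × Circle → S,
    ContMDiff (𝓘(ℝ, ℝ).prod (𝓡 1)) (𝓡 2) ∞ F ∧
    (∀ t ∈ Set.Icc (0 : ℝ) 1,
      Manifold.IsSmoothEmbedding (𝓡 1) (𝓡 2) ∞ (fun z => F (t, z)) ∧ ∀ z, F (t, z) ∉ P) ∧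
    Set.range (fun z => F (0, z)) = c.carrier ∧
    Set.range (fun z => F (1, z)) = d.carrier

/-- The curve can be isotoped, in `S ∖ P`, into every neighbourhood of the marked point `p`. -/
def IsotopicToPuncture (c : SimpleClosedCurve S P) (p : S) : Prop :=
  ∀ U ∈ 𝓝 p, ∃ d : SimpleClosedCurve S P, c.Isotopic d ∧ d.carrier ⊆ U

/-- A curve is essential if it is not null-homotopic in `S ∖ P` and not isotopic to a puncture. -/
def IsEssential (c : SimpleClosedCurve S P) : Prop :=
  ¬ c.toPunctured.Nullhomotopic ∧ ∀ p ∈ P, ¬ c.IsotopicToPuncture p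

/-- Two curves meet transversely: at every common point their tangent lines span the tangent
plane of the surface. -/
def Transverse (c d : SimpleClosedCurve S P) : Prop :=
  ∀ s t : Circle, c.toFun s = d.toFun t →
    (LinearMap.range (mfderiv (𝓡 1) (𝓡 2) c.toFun s).toLinearMap :
        Submodule ℝ (EuclideanSpace ℝ (Fin 2))) ⊔
      LinearMap.range (mfderiv (𝓡 1) (𝓡 2) d.toFun t).toLinearMap = ⊤

/-- The geometric intersection number `i(c, d)`: the minimal number of intersection points among
all transverse pairs of representatives of the isotopy classes of `c` and `d`. (Transverse curves
meet in finitely many points.) -/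
def geometricIntersection (c d : SimpleClosedCurve S P) : ℕ :=
  sInf {k | ∃ c' d' : SimpleClosedCurve S P, c.Isotopic c' ∧ d.Isotopic d' ∧ c'.Transverse d' ∧
    k = (c'.carrier ∩ d'.carrier).ncard}

end SimpleClosedCurve

/-- An essential closed `1`-manifold `A = a₁ ∪ ⋯ ∪ aₙ` embedded in `S ∖ P`, with its components
labelled: pairwise disjoint essential simple closed curves (isotopic ones are allowed). -/
structure EssentialOneManifold (S : Type*) [TopologicalSpace S]
    [ChartedSpace (EuclideanSpace ℝ (Fin 2)) S] (P : Finset S) (n : ℕ) where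
  component : Fin n → SimpleClosedCurve S P
  isEssential : ∀ i, (component i).IsEssential
  disjoint : ∀ i j, i ≠ j → Disjoint (component i).carrier (component j).carrier

/-- The adjacency matrix of a multigraph: the `(x, y)` entry is the number of edges joining `x`
to `y`. -/
def Graph.adjacencyMatrix {α β : Type*} (G : Graph α β) : Matrix α α ℝ :=
  Matrix.of fun x y => ({e | G.IsLink e x y}.ncard : ℝ)

/-- The spectral radius `μ(M)` of a real square matrix: the maximum of the moduli of its complex
eigenvalues. -/
def Matrix.mu {ι : Type*} [Fintype ι] [DecidableEq ι] (M : Matrix ι ι ℝ) : ℝ :=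
  (spectralRadius ℂ (M.map (algebraMap ℝ ℂ))).toReal

/-- The spectral radius of a multigraph with a finite type of vertices. -/
def Graph.mu {α β : Type*} [Fintype α] [DecidableEq α] (G : Graph α β) : ℝ :=
  G.adjacencyMatrix.mu

namespace EssentialOneManifold

variable {S : Type*} [TopologicalSpace S] [ChartedSpace (EuclideanSpace ℝ (Fin 2)) S]
  {P : Finset S} {n m : ℕ}

/-- `A` and `B` meet transversely. -/
def MeetTransversely (A : EssentialOneManifold S P n) (B : EssentialOneManifold S P m) : Prop :=
  ∀ i j, (A.component i).Transverse (B.component j)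

/-- `A` and `B` meet minimally: the number of points in which a component of `A` meets a component
of `B` cannot be decreased by isotopies of these two curves. -/
def MeetMinimally (A : EssentialOneManifold S P n) (B : EssentialOneManifold S P m) : Prop :=
  ∀ i j, ∀ a b : SimpleClosedCurve S P,
    (A.component i).Isotopic a → (B.component j).Isotopic b → a.Transverse b →
      ((A.component i).carrier ∩ (B.component j).carrier).ncard ≤ (a.carrier ∩ b.carrier).ncard

/-- The components of `A` and of `B`, as one labelled family. -/
def curves (A : EssentialOneManifold S P n) (B : EssentialOneManifold S P m) :
    Fin n ⊕ Fin m → SimpleClosedCurve S P :=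
  Sum.elim A.component B.component

/-- The configuration graph `𝒢(A ∪ B)`: it has a vertex for each component of `A` and of `B`, and
an edge for every point of intersection between two of these components, joining the two
corresponding vertices. -/
def configurationGraph (A : EssentialOneManifold S P n) (B : EssentialOneManifold S P m) :
    Graph (Fin n ⊕ Fin m) S where
  vertexSet := Set.univ
  IsLink p x y := x ≠ y ∧ p ∈ (curves A B x).carrier ∩ (curves A B y).carrier
  isLink_symm _ _ := ⟨fun _ _ h => ⟨h.1.symm, h.2.symm⟩⟩
  eq_or_eq_of_isLink_of_isLink := by
    have hA : ∀ {p i j}, p ∈ (A.component i).carrier → p ∈ (A.component j).carrier → i = j :=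
      fun {p i j} hi hj => by
        by_contra h
        exact Set.disjoint_left.1 (A.disjoint i j h) hi hj
    have hB : ∀ {p i j}, p ∈ (B.component i).carrier → p ∈ (B.component j).carrier → i = j :=
      fun {p i j} hi hj => by
        by_contra h
        exact Set.disjoint_left.1 (B.disjoint i j h) hi hj
    rintro p (x | x) (y | y) (v | v) (w | w) ⟨h1, h2, h3⟩ ⟨h4, h5, h6⟩ <;>
      simp only [curves, Sum.elim_inl, Sum.elim_inr, ne_eq, Sum.inl.injEq, Sum.inr.injEq,
        reduceCtorEq, not_false_eq_true, false_or, or_false] at * <;>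
      first
        | exact hA h2 h5
        | exact hB h2 h5
        | exact hA h2 h6
        | exact hB h2 h6
        | exact absurd (hA h2 h3) h1
        | exact absurd (hB h2 h3) h1
        | exact absurd (hA h5 h6) h4
        | exact absurd (hB h5 h6) h4
  left_mem_of_isLink _ _ _ _ := Set.mem_univ _

/-- The matrix `N` of geometric intersection numbers `N i j = i(aᵢ, bⱼ)`. -/
def intersectionMatrix (A : EssentialOneManifold S P n) (B : EssentialOneManifold S P m) :
    Matrix (Fin n) (Fin m) ℝ :=
  Matrix.of fun i j => ((A.component i).geometricIntersection (B.component j) : ℝ)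

/-- Thurston's parameter `μ(A ∪ B)`, the square root of the spectral radius of `N Nᵗ`. -/
def thurstonParameter (A : EssentialOneManifold S P n) (B : EssentialOneManifold S P m) : ℝ :=
  √(intersectionMatrix A B * (intersectionMatrix A B).transpose).mu

end EssentialOneManifold

end

/-! Minimal position says that each pair `aᵢ`, `bⱼ` already attains the infimum defining `i(aᵢ,
bⱼ)`, so the off-diagonal blocks of the adjacency matrix are `N` and `Nᵗ`. Components of the same
manifold are disjoint, so the diagonal blocks vanish. The rest is linear algebra: the square of the
bipartite matrix is block diagonal with blocks `N Nᵗ` and `Nᵗ N`, whose spectra agree away from `0`.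
Hence the squared spectral radius of the bipartite matrix is that of `N Nᵗ`. -/

/-- Isotopy is reflexive: the constant family is an isotopy. -/
theorem SimpleClosedCurve.Isotopic.refl {S : Type*} [TopologicalSpace S]
    [ChartedSpace (EuclideanSpace ℝ (Fin 2)) S] {P : Finset S} (c : SimpleClosedCurve S P) :
    c.Isotopic c :=
  ⟨fun q => c.toFun q.2, c.isSmoothEmbedding.contMDiff.comp contMDiff_snd,
    fun _ _ => ⟨c.isSmoothEmbedding, c.avoids⟩, rfl, rfl⟩

/-- Curves in transverse and minimal position realize the geometric intersection number. -/
theorem EssentialOneManifold.ncard_inter_eq_geometricIntersection {S : Type*} [TopologicalSpace S]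
    [ChartedSpace (EuclideanSpace ℝ (Fin 2)) S] {P : Finset S} {n m : ℕ}
    {A : EssentialOneManifold S P n} {B : EssentialOneManifold S P m}
    (htransverse : A.MeetTransversely B) (hminimal : A.MeetMinimally B) (i : Fin n) (j : Fin m) :
    ((A.component i).carrier ∩ (B.component j).carrier).ncard =
      (A.component i).geometricIntersection (B.component j) := by
  -- The given pair competes in the infimum, being transverse. This also makes the set nonempty, so
  -- the junk value `sInf ∅ = 0` does not arise.
  have hmem : ((A.component i).carrier ∩ (B.component j).carrier).ncard ∈
      {k | ∃ c' d' : SimpleClosedCurve S P, (A.component i).Isotopic c' ∧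
        (B.component j).Isotopic d' ∧ c'.Transverse d' ∧
        k = (c'.carrier ∩ d'.carrier).ncard} :=
    ⟨_, _, .refl _, .refl _, htransverse i j, rfl⟩
  refine le_antisymm (le_csInf ⟨_, hmem⟩ ?_) (Nat.sInf_le hmem)
  rintro k ⟨a, b, ha, hb, hab, rfl⟩
  exact hminimal i j a b ha hb hab

/-- The adjacency matrix of the configuration graph is the bipartite block matrix of geometric
intersection numbers. -/
theorem EssentialOneManifold.adjacencyMatrix_configurationGraph {S : Type*} [TopologicalSpace S]
    [ChartedSpace (EuclideanSpace ℝ (Fin 2)) S] {P : Finset S} {n m : ℕ}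
    {A : EssentialOneManifold S P n} {B : EssentialOneManifold S P m}
    (htransverse : A.MeetTransversely B) (hminimal : A.MeetMinimally B) :
    (A.configurationGraph B).adjacencyMatrix =
      Matrix.fromBlocks 0 (A.intersectionMatrix B) (A.intersectionMatrix B).transpose 0 := by
  have key := ncard_inter_eq_geometricIntersection htransverse hminimal
  -- For `i = j` the set is empty because the graph has no loops, for `i ≠ j` by disjointness.
  have hAA : ∀ i j, {p | i ≠ j ∧ p ∈ (A.component i).carrier ∩ (A.component j).carrier} = ∅ :=
    fun i j => Set.eq_empty_of_forall_notMem fun p hp =>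
      Set.disjoint_left.1 (A.disjoint i j hp.1) hp.2.1 hp.2.2
  have hBB : ∀ i j, {p | i ≠ j ∧ p ∈ (B.component i).carrier ∩ (B.component j).carrier} = ∅ :=
    fun i j => Set.eq_empty_of_forall_notMem fun p hp =>
      Set.disjoint_left.1 (B.disjoint i j hp.1) hp.2.1 hp.2.2
  ext (i | i) (j | j)
  · simpa [Graph.adjacencyMatrix, configurationGraph, curves] using
      congrArg Set.ncard (hAA i j)
  · simp [Graph.adjacencyMatrix, configurationGraph, curves, intersectionMatrix, ← key,
      -Set.mem_inter_iff]
  · simp [Graph.adjacencyMatrix, configurationGraph, curves, intersectionMatrix, ← key,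
      -Set.mem_inter_iff, Set.inter_comm]
  · simpa [Graph.adjacencyMatrix, configurationGraph, curves] using
      congrArg Set.ncard (hBB i j)

/-- The spectrum of a block diagonal matrix is the union of the spectra of the blocks. -/
theorem Matrix.spectrum_fromBlocks_diagonal {𝕜 ι κ : Type*} [Field 𝕜] [Fintype ι] [DecidableEq ι]
    [Fintype κ] [DecidableEq κ] (C : Matrix ι ι 𝕜) (D : Matrix κ κ 𝕜) :
    spectrum 𝕜 (fromBlocks C 0 0 D) = spectrum 𝕜 C ∪ spectrum 𝕜 D := by
  ext z
  simp [Matrix.mem_spectrum_iff_isRoot_charpoly, Polynomial.IsRoot]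

/-- For rectangular matrices, `C * D` and `D * C` have the same nonzero spectrum. -/
theorem Matrix.mem_spectrum_mul_comm {𝕜 ι κ : Type*} [Field 𝕜] [Fintype ι] [DecidableEq ι]
    [Fintype κ] [DecidableEq κ] (C : Matrix ι κ 𝕜) (D : Matrix κ ι 𝕜) {z : 𝕜} (hz : z ≠ 0) :
    z ∈ spectrum 𝕜 (C * D) ↔ z ∈ spectrum 𝕜 (D * C) := by
  -- The characteristic polynomials of `C * D` and `D * C` agree up to powers of `X`, which do not
  -- vanish at `z ≠ 0`.
  have h := congrArg (Polynomial.eval z) (charpoly_mul_comm' C D)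
  simp only [Polynomial.eval_mul, Polynomial.eval_pow, Polynomial.eval_X] at h
  simp only [Matrix.mem_spectrum_iff_isRoot_charpoly, Polynomial.IsRoot]
  constructor <;> intro h0 <;> simpa [h0, hz] using h

/-- The square of the spectral radius of a bipartite block matrix is the spectral radius of the
product of the blocks. -/
theorem Matrix.spectralRadius_fromBlocks_sq {ι κ : Type*} [Fintype ι] [DecidableEq ι]
    [Fintype κ] [DecidableEq κ] (C : Matrix ι κ ℂ) (D : Matrix κ ι ℂ) :
    spectralRadius ℂ (fromBlocks 0 C D 0) ^ 2 = spectralRadius ℂ (C * D) := by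
  have hsq : fromBlocks 0 C D 0 ^ 2 = fromBlocks (C * D) 0 0 (D * C) := by
    simp [sq, fromBlocks_multiply]
  have hspec := spectrum_fromBlocks_diagonal (C * D) (D * C)
  rw [← hsq] at hspec
  apply le_antisymm
  · refine (spectrum.spectralRadius_pow_le _ 2 two_ne_zero).trans (iSup₂_le fun z hz => ?_)
    -- `0` may be an eigenvalue of `D * C` only, but it contributes nothing to the supremum.
    rcases eq_or_ne z 0 with rfl | h0
    · simp
    rw [hspec] at hz
    exact le_iSup₂_of_le z (hz.elim id (mem_spectrum_mul_comm C D h0).2) le_rfl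
  · refine iSup₂_le fun z hz => ?_
    have hz' : z ∈ spectrum ℂ (fromBlocks 0 C D 0 ^ 2) := hspec ▸ Or.inl hz
    -- Spectral mapping: every eigenvalue of the square is `w ^ 2` for an eigenvalue `w` of the
    -- bipartite matrix.
    rw [spectrum.map_pow_of_pos _ two_pos] at hz'
    obtain ⟨w, hw, rfl⟩ := hz'
    simp only [nnnorm_pow, ENNReal.coe_pow]
    gcongr
    exact le_iSup₂_of_le w hw le_rfl

/-- The spectral radius of a symmetric bipartite block matrix. -/
theorem Matrix.sqrt_mu_mul_transpose {ι κ : Type*} [Fintype ι] [DecidableEq ι]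
    [Fintype κ] [DecidableEq κ] (N : Matrix ι κ ℝ) :
    √(N * N.transpose).mu = (fromBlocks 0 N N.transpose 0).mu := by
  have hmap : (N * N.transpose).map (algebraMap ℝ ℂ) =
      N.map (algebraMap ℝ ℂ) * N.transpose.map (algebraMap ℝ ℂ) := Matrix.map_mul
  rw [mu, mu, hmap, ← spectralRadius_fromBlocks_sq, fromBlocks_map, ENNReal.toReal_pow,
    Real.sqrt_sq ENNReal.toReal_nonneg]
  simp

theorem mainTheorem8 {S : Type*} [TopologicalSpace S] [T2Space S] [CompactSpace S]
    [ConnectedSpace S] [ChartedSpace (EuclideanSpace ℝ (Fin 2)) S] [IsManifold (𝓡 2) ∞ S]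
    (hS : OrientableSurface S) (P : Finset S) {n m : ℕ}
    (A : EssentialOneManifold S P n) (B : EssentialOneManifold S P m)
    (htransverse : A.MeetTransversely B) (hminimal : A.MeetMinimally B) :
    (A.configurationGraph B).adjacencyMatrix =
        Matrix.fromBlocks 0 (A.intersectionMatrix B) (A.intersectionMatrix B).transpose 0 ∧
      A.thurstonParameter B =
        √(A.intersectionMatrix B * (A.intersectionMatrix B).transpose).mu ∧
      A.thurstonParameter B = (A.configurationGraph B).mu := by
  have hadj := EssentialOneManifold.adjacencyMatrix_configurationGraph htransverse hminimal
  refine ⟨hadj, rfl, ?_⟩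
  rw [Graph.mu, hadj]
  exact Matrix.sqrt_mu_mul_transpose _
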